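/- Let $\mathcal{H},\mathcal{K}$ be complex Hilbert spaces and let $\Phi:\mathcal{B}(\mathcal{H})\to\mathcal{B}(\mathcal{K})$ be a positive unital linear map, i.e. $\Phi$ is linear, $\Phi(X)\ge 0$ whenever $X\ge 0$, and $\Phi(I)=I$. Let $m,m',M',M$ be real numbers and let $A,B\in\mathcal{B}(\mathcal{H})$ satisfy $$0<mI\le B\le m'I<M'I\le A\le MI\qquad\text{or}\qquad 0<mI\le A\le m'I<M'I\le B\le MI,$$ where $\le$ between operators is the Loewner order, and $0<m$, $m'<M'$ as real numbers. Let $\nu\in[0,1]$, $r=\min\{\nu,1-\nu\}$, $h=M/m$, $h'=M'/m'$ and $K(t)=\frac{(t+1)^2}{4t}$. For $S,T>0$ invertible write $$S\nabla_\nu T=(1-\nu)S+\nu T,\qquad S\#_\nu T=S^{1/2}\left(S^{-1/2}TS^{-1/2}\right)^{\nu}S^{1/2}.$$ Then $$\Phi(A\nabla_\nu B)^2\le\left(\frac{K(h)}{K(h')^{r}}\right)^2\Phi(A\#_\nu B)^2 \qquad\text{and}\qquad \Phi(A\nabla_\nu B)^2\le\left(\frac{K(h)}{K(h')^{r}}\right)^2\bigl(\Phi(A)\#_\nu\Phi(B)\bigr)^2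 .$$ -/

import Mathlib

noncomputable section

/-- The Kantorovich constant `K(h) = (h + 1)² / (4 h)`. -/
def kantorovich (h : ℝ) : ℝ := (h + 1) ^ 2 / (4 * h)

/-- The weighted operator arithmetic mean `A ∇_ν B = (1 - ν) A + ν B`. -/
def arithMean {H : Type*} [NormedAddCommGroup H] [InnerProductSpace ℂ H] [CompleteSpace H]
    (ν : ℝ) (A B : H →L[ℂ] H) : H →L[ℂ] H :=
  (1 - ν) • A + ν • B

/-- The weighted operator geometric mean
`A #_ν B = A^(1/2) (A^(-1/2) B A^(-1/2))^ν A^(1/2)` (for strictly positive `A`, `B`); the powers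
are those of the continuous functional calculus. -/
def geomMean {H : Type*} [NormedAddCommGroup H] [InnerProductSpace ℂ H] [CompleteSpace H]
    (ν : ℝ) (A B : H →L[ℂ] H) : H →L[ℂ] H :=
  A ^ (1 / 2 : ℝ) * (A ^ (-(1 / 2) : ℝ) * B * A ^ (-(1 / 2) : ℝ)) ^ ν * A ^ (1 / 2 : ℝ)

end

/-! Write `G = A #_ν B`, `κ = K(h')^r`. Since `(x - m)(M - x) ≥ 0` on the spectra, `X + Mm X⁻¹ ≤ M +
m` for `X = A, B`; averaging and the refined Young inequality `κ G⁻¹ ≤ A⁻¹ ∇_ν B⁻¹` give `A ∇_ν B +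
Mmκ G⁻¹ ≤ M + m`. Applying `Φ` and Choi's inequality `Φ(G)⁻¹ ≤ Φ(G⁻¹)` yields `P + c Q⁻¹ ≤ N` with
`P = Φ(A ∇_ν B)`, `Q = Φ(G)`, `c = Mmκ`, `N = M + m`. The Bhatia–Kittaneh bound turns this into `‖P
Q⁻¹‖ ≤ N²/(4c) = K(h)/κ`, that is, `P² ≤ (K(h)/κ)² Q²`.

The second inequality is the first one for the identity map and the operators `Φ(A)`, `Φ(B)`. -/

/-! ### Bernstein approximation of the inverse -/

/-- A continuous substitute for the spectral measure in Choi's inequality: Bernstein polynomials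
reproduce affine functions, and their variance controls the error for `x⁻¹`. -/
theorem exists_bernstein_partition {a b : ℝ} (ha : 0 < a) (hab : a < b) {ε : ℝ} (hε : 0 < ε) :
    ∃ (n : ℕ) (t : ℕ → ℝ) (g : ℕ → ℝ → ℝ), (∀ k, 0 < t k) ∧ (∀ k, Continuous (g k)) ∧
      ∀ x ∈ Set.Icc a b, (∀ k, 0 ≤ g k x) ∧ ∑ k ∈ Finset.range n, g k x = 1 ∧
        ∑ k ∈ Finset.range n, t k * g k x = x ∧
        ∑ k ∈ Finset.range n, (t k)⁻¹ * g k x ≤ x⁻¹ + ε := by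
  obtain ⟨n, hn⟩ := exists_nat_gt ((b - a) ^ 2 / (a ^ 3 * ε))
  have hba : 0 < b - a := sub_pos.2 hab
  have hn0 : (0 : ℝ) < n := lt_of_le_of_lt (by positivity) hn
  have ht (k : ℕ) : a ≤ a + (b - a) * (k / n) := by
    have : 0 ≤ (b - a) * (k / n : ℝ) := by positivity
    linarith
  refine ⟨n + 1, fun k => a + (b - a) * (k / n),
    fun k x => (bernsteinPolynomial ℝ n k).eval ((x - a) / (b - a)),
    fun k => ha.trans_le (ht k), fun k => by fun_prop, ?_⟩
  rintro x ⟨hax, hxb⟩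
  have hx : 0 < x := ha.trans_le hax
  obtain ⟨s, hs⟩ : ∃ s, s = (x - a) / (b - a) := ⟨_, rfl⟩
  have hxs : x = a + (b - a) * s := by rw [hs]; field_simp; ring
  have hs0 : 0 ≤ s := by rw [hs]; exact div_nonneg (by linarith) hba.le
  have hs1 : s ≤ 1 := by rw [hs, div_le_one hba]; linarith
  have hg (k : ℕ) : 0 ≤ (bernsteinPolynomial ℝ n k).eval s := by
    have : 0 ≤ 1 - s := by linarith
    simp only [bernsteinPolynomial, Polynomial.eval_mul, Polynomial.eval_pow,
      Polynomial.eval_natCast, Polynomial.eval_X, Polynomial.eval_sub, Polynomial.eval_one]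
    positivity
  have h1 : ∑ k ∈ Finset.range (n + 1), (bernsteinPolynomial ℝ n k).eval s = 1 := by
    simpa [Polynomial.eval_finsetSum] using congr_arg (Polynomial.eval s) (bernsteinPolynomial.sum ℝ n)
  have h2 : ∑ k ∈ Finset.range (n + 1), k * (bernsteinPolynomial ℝ n k).eval s = n * s := by
    simpa [Polynomial.eval_finsetSum] using
      congr_arg (Polynomial.eval s) (bernsteinPolynomial.sum_smul ℝ n)
  have h3 : ∑ k ∈ Finset.range (n + 1), (n * s - k) ^ 2 * (bernsteinPolynomial ℝ n k).eval s
      = n * s * (1 - s) := by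
    simpa [Polynomial.eval_finsetSum] using
      congr_arg (Polynomial.eval s) (bernsteinPolynomial.variance ℝ n)
  simp only [← hs]
  have h4 : ∑ k ∈ Finset.range (n + 1),
      (a + (b - a) * (k / n)) * (bernsteinPolynomial ℝ n k).eval s = x := by
    have : ∀ k : ℕ, (a + (b - a) * (k / n)) * (bernsteinPolynomial ℝ n k).eval s =
        a * (bernsteinPolynomial ℝ n k).eval s +
          (b - a) / n * (k * (bernsteinPolynomial ℝ n k).eval s) := fun k => by ring
    simp only [this, Finset.sum_add_distrib, ← Finset.mul_sum, h1, h2]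
    rw [hxs]; field_simp
  refine ⟨hg, h1, h4, ?_⟩
  calc ∑ k ∈ Finset.range (n + 1), (a + (b - a) * (k / n))⁻¹ * (bernsteinPolynomial ℝ n k).eval s
      ≤ ∑ k ∈ Finset.range (n + 1), ((2 * x⁻¹) * (bernsteinPolynomial ℝ n k).eval s
          - (x⁻¹) ^ 2 * ((a + (b - a) * (k / n)) * (bernsteinPolynomial ℝ n k).eval s)
          + ((b - a) ^ 2 / (a ^ 3 * n ^ 2)) *
            ((n * s - k) ^ 2 * (bernsteinPolynomial ℝ n k).eval s)) := by
        refine Finset.sum_le_sum fun k _ => ?_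
        have htk := ht k
        obtain ⟨t, htt⟩ : ∃ t, t = a + (b - a) * (k / n : ℝ) := ⟨_, rfl⟩
        have hd : (b - a) ^ 2 * (n * s - k) ^ 2 / n ^ 2 = (x - t) ^ 2 := by
          rw [hxs, htt]; field_simp; ring
        rw [← htt] at htk ⊢
        have ht0 : 0 < t := ha.trans_le htk
        -- Tangent line of `t⁻¹` at `x` plus its exact remainder, bounded using `a ≤ x, t`; the
        -- quadratic term sums to the Bernstein variance.
        have key : t⁻¹ ≤ 2 * x⁻¹ - (x⁻¹) ^ 2 * t + (x - t) ^ 2 / a ^ 3 := by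
          have e : t⁻¹ = 2 * x⁻¹ - (x⁻¹) ^ 2 * t + (x - t) ^ 2 / (x ^ 2 * t) := by
            field_simp; ring
          rw [e]
          have : a ^ 3 ≤ x ^ 2 * t := by
            calc a ^ 3 = a ^ 2 * a := by ring
              _ ≤ x ^ 2 * t := by gcongr
          gcongr
        calc t⁻¹ * _ ≤ (2 * x⁻¹ - (x⁻¹) ^ 2 * t + (x - t) ^ 2 / a ^ 3) * _ :=
              mul_le_mul_of_nonneg_right key (hg k)
          _ = _ := by rw [← hd]; field_simp
    _ = x⁻¹ + (b - a) ^ 2 / a ^ 3 / n * (s * (1 - s)) := by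
        rw [Finset.sum_add_distrib, Finset.sum_sub_distrib, ← Finset.mul_sum, ← Finset.mul_sum,
          ← Finset.mul_sum, h1, h3, h4]
        field_simp; ring
    _ ≤ x⁻¹ + ε * 1 := by
        have e1 : (b - a) ^ 2 / a ^ 3 / n ≤ ε := by
          rw [div_lt_iff₀ (by positivity)] at hn
          rw [div_div, div_le_iff₀ (by positivity)]
          linarith
        have e2 : s * (1 - s) ≤ 1 := by nlinarith
        have e3 : 0 ≤ s * (1 - s) := mul_nonneg hs0 (by linarith)
        gcongr
    _ = _ := by ring

/-! ### Scalar refined Young inequality -/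

theorem one_le_kantorovich {h : ℝ} (hh : 0 < h) : 1 ≤ kantorovich h := by
  rw [kantorovich, le_div_iff₀ (by positivity)]
  nlinarith [sq_nonneg (h - 1)]

theorem kantorovich_inv (h : ℝ) : kantorovich h⁻¹ = kantorovich h := by
  rcases eq_or_ne h 0 with rfl | hh
  · simp
  · unfold kantorovich
    field_simp
    ring

theorem kantorovich_mono {h x : ℝ} (hh : 1 ≤ h) (hx : h ≤ x) : kantorovich h ≤ kantorovich x := by
  have h0 : 0 < h := by linarith
  have x0 : 0 < x := by linarith
  rw [kantorovich, kantorovich, div_le_div_iff₀ (by positivity) (by positivity)]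
  nlinarith [mul_nonneg (sub_nonneg.2 hx) (sub_nonneg.2 (one_le_mul_of_one_le_of_one_le hh (hh.trans hx)))]

/-- As `K(y) y = ((1 + y)/2)²`, Bernoulli's inequality with exponent `2p ≤ 1` settles `p = ν ≤ 1/2`;
the other half follows by `x ↦ x⁻¹`, `ν ↦ 1 - ν`. -/
theorem kantorovich_rpow_mul_rpow_le {x ν : ℝ} (hx : 0 < x) (hν : ν ∈ Set.Icc (0 : ℝ) 1) :
    kantorovich x ^ min ν (1 - ν) * x ^ ν ≤ 1 - ν + ν * x := by
  obtain ⟨h0, h1⟩ := hν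
  have half (y p : ℝ) (hy : 0 < y) (hp0 : 0 ≤ p) (hp : p ≤ 1 / 2) :
      (kantorovich y * y) ^ p ≤ 1 - p + p * y := by
    have e : kantorovich y * y = (1 + (y - 1) / 2) ^ (2 : ℝ) := by
      rw [Real.rpow_two, kantorovich]; field_simp; ring
    have := rpow_one_add_le_one_add_mul_self (s := (y - 1) / 2) (by linarith)
      (p := 2 * p) (by linarith) (by linarith)
    rw [e, ← Real.rpow_mul (by linarith)]
    linarith
  have hK : 0 < kantorovich x := zero_lt_one.trans_le (one_le_kantorovich hx)
  rcases le_total ν (1 / 2) with h | h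
  · rw [min_eq_left (by linarith), ← Real.mul_rpow hK.le hx.le]
    exact half x ν hx h0 h
  · rw [min_eq_right (by linarith)]
    have := half x⁻¹ (1 - ν) (by positivity) (by linarith) (by linarith)
    rw [kantorovich_inv, Real.mul_rpow hK.le (by positivity), Real.inv_rpow hx.le,
      Real.rpow_sub hx, Real.rpow_one] at this
    have hxν : 0 < x ^ ν := by positivity
    calc _ = x * (kantorovich x ^ (1 - ν) * (x / x ^ ν)⁻¹) := by field_simp
      _ ≤ x * (1 - (1 - ν) + (1 - ν) * x⁻¹) := by gcongr
      _ = _ := by field_simp; ring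

theorem kantorovich_rpow_mul_rpow_neg_le {h x ν : ℝ} (hh : 1 ≤ h) (hx : 0 < x)
    (hhx : h ≤ x ∨ x ≤ h⁻¹) (hν : ν ∈ Set.Icc (0 : ℝ) 1) :
    kantorovich h ^ min ν (1 - ν) * x ^ (-ν) ≤ 1 - ν + ν * x⁻¹ := by
  have h0 : 0 < h := by linarith
  have hK : kantorovich h ≤ kantorovich x⁻¹ := by
    rcases hhx with hx' | hx'
    · rw [kantorovich_inv]
      exact kantorovich_mono hh hx'
    · exact kantorovich_mono hh ((le_inv_comm₀ hx h0).1 hx')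
  have hK0 : 0 < kantorovich h := zero_lt_one.trans_le (one_le_kantorovich h0)
  refine le_trans ?_ (kantorovich_rpow_mul_rpow_le (inv_pos.2 hx) hν)
  rw [Real.inv_rpow hx.le, ← Real.rpow_neg hx.le]
  have : 0 ≤ min ν (1 - ν) := le_min hν.1 (by linarith [hν.2])
  gcongr

/-! ### Choi's inequality for positive unital maps -/

section PositiveMaps

variable {𝒜 : Type*} [CStarAlgebra 𝒜] [PartialOrder 𝒜] [StarOrderedRing 𝒜]
variable {ℬ : Type*} [CStarAlgebra ℬ] [PartialOrder ℬ] [StarOrderedRing ℬ]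

theorem le_of_forall_pos_le_add_algebraMap {x y : 𝒜}
    (h : ∀ ε : ℝ, 0 < ε → x ≤ y + algebraMap ℝ 𝒜 ε) : x ≤ y := by
  have ht : Filter.Tendsto (fun ε : ℝ => y + algebraMap ℝ 𝒜 ε) (nhdsWithin 0 (Set.Ioi 0))
      (nhds (y + algebraMap ℝ 𝒜 0)) :=
    ((continuous_const.add (continuous_algebraMap ℝ 𝒜)).tendsto 0).mono_left nhdsWithin_le_nhds
  rw [map_zero, add_zero] at ht
  exact ge_of_tendsto ht (eventually_nhdsWithin_of_forall h)

omit [StarOrderedRing 𝒜] [StarOrderedRing ℬ] in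
theorem PositiveLinearMap.map_algebraMap (Φ : 𝒜 →ₚ[ℂ] ℬ) (hΦ : Φ 1 = 1) (r : ℝ) :
    Φ (algebraMap ℝ 𝒜 r) = algebraMap ℝ ℬ r := by
  rw [Algebra.algebraMap_eq_smul_one, Algebra.algebraMap_eq_smul_one, Φ.map_smul_of_tower, hΦ]

theorem IsStrictlyPositive.exists_algebraMap_le {X : 𝒜} (hX : IsStrictlyPositive X) :
    ∃ a : ℝ, 0 < a ∧ algebraMap ℝ 𝒜 a ≤ X := by
  rcases subsingleton_or_nontrivial 𝒜 with _ | _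
  · exact ⟨1, one_pos, (Subsingleton.elim _ _).le⟩
  · obtain ⟨a, ha, h⟩ := (CFC.exists_pos_algebraMap_le_iff hX.isSelfAdjoint).2
      fun x hx => hX.spectrum_pos hx
    exact ⟨a, ha, h⟩

theorem IsStrictlyPositive.of_algebraMap_le {X : 𝒜} {a : ℝ} (ha : 0 < a)
    (h : algebraMap ℝ 𝒜 a ≤ X) : IsStrictlyPositive X :=
  (isStrictlyPositive_algebraMap ha).of_le h

/-- With `E_k = Φ(g_k(X)) ≥ 0` and `∑ E_k = 1`, expand `∑ t_k⁻¹ (1 - t_k S) E_k (1 - t_k S) ≥ 0`.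
Only positivity of `Φ` on the commuting `g_k(X)` is used, so complete positivity is not needed. -/
theorem PositiveLinearMap.two_smul_sub_conjugate_le_map_rpow_neg_one
    (Φ : 𝒜 →ₚ[ℂ] ℬ) (hΦ : Φ 1 = 1) {X : 𝒜} (hX : IsStrictlyPositive X) {S : ℬ}
    (hS : IsSelfAdjoint S) :
    (2 : ℝ) • S - S * Φ X * S ≤ Φ (X ^ (-1 : ℝ)) := by
  obtain ⟨a, ha, haX⟩ := hX.exists_algebraMap_le
  refine le_of_forall_pos_le_add_algebraMap fun ε hε => ?_
  obtain ⟨n, t, g, ht, hg, hx⟩ := exists_bernstein_partition ha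
    -- The `+ 1` keeps the interval nondegenerate when `‖X‖ = 0`.
    (show a < a + ‖X‖ + 1 by linarith [norm_nonneg X]) hε
  have hsp : ∀ x ∈ spectrum ℝ X, x ∈ Set.Icc a (a + ‖X‖ + 1) := fun x hx => by
    refine ⟨(algebraMap_le_iff_le_spectrum hX.isSelfAdjoint).1 haX x hx, ?_⟩
    have := (le_algebraMap_iff_spectrum_le hX.isSelfAdjoint).1
      hX.isSelfAdjoint.le_algebraMap_norm_self x hx
    linarith
  have hXsa := hX.isSelfAdjoint
  have hg' (k : ℕ) : ContinuousOn (g k) (spectrum ℝ X) := (hg k).continuousOn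
  have hinv : ContinuousOn (fun x : ℝ => x⁻¹) (spectrum ℝ X) :=
    continuousOn_inv₀.mono fun x h => (hX.spectrum_pos h).ne'
  have hgs (r : ℝ) (k : ℕ) : ContinuousOn (fun x => r • g k x) (spectrum ℝ X) := by fun_prop
  have h1 : ∑ k ∈ Finset.range n, cfc (g k) X = 1 := by
    rw [← cfc_sum g X _ fun k _ => hg' k, ← cfc_one ℝ X]
    exact cfc_congr fun x h => by simpa using (hx x (hsp x h)).2.1
  have h2 : ∑ k ∈ Finset.range n, t k • cfc (g k) X = X := by
    simp only [← cfc_smul (t _) _ X (hg' _)]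
    rw [← cfc_sum (fun k x => t k • g k x) X _ fun k _ => hgs _ k]
    conv_rhs => rw [← cfc_id ℝ X]
    exact cfc_congr fun x h => by simpa using (hx x (hsp x h)).2.2.1
  have h3 : ∑ k ∈ Finset.range n, (t k)⁻¹ • cfc (g k) X ≤ X ^ (-1 : ℝ) + algebraMap ℝ 𝒜 ε := by
    simp only [← cfc_smul (t _)⁻¹ _ X (hg' _)]
    rw [← cfc_sum (fun k x => (t k)⁻¹ • g k x) X _ fun k _ => hgs _ k, CFC.rpow_eq_cfc_real hX.nonneg,
      ← cfc_const ε X]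
    simp only [Real.rpow_neg_one]
    rw [← cfc_add X _ _ hinv]
    refine cfc_mono (fun x h => by simpa using (hx x (hsp x h)).2.2.2) ?_ ?_
    · rw [Finset.sum_fn]
      exact continuousOn_finsetSum _ fun k _ => hgs _ k
    · exact hinv.add continuousOn_const
  have hE (k : ℕ) : 0 ≤ Φ (cfc (g k) X) :=
    Φ.map_nonneg (cfc_nonneg fun x h => (hx x (hsp x h)).1 k)
  have hpos : 0 ≤ ∑ k ∈ Finset.range n,
      (t k)⁻¹ • ((1 - t k • S) * Φ (cfc (g k) X) * (1 - t k • S)) :=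
    Finset.sum_nonneg fun k _ => smul_nonneg (inv_nonneg.2 (ht k).le) <|
      IsSelfAdjoint.conjugate_nonneg (hE k)
        ((IsSelfAdjoint.one ℬ).sub ((IsSelfAdjoint.all (t k)).smul hS))
  have hterm (k : ℕ) : (t k)⁻¹ • ((1 - t k • S) * Φ (cfc (g k) X) * (1 - t k • S)) =
      (t k)⁻¹ • Φ (cfc (g k) X) - S * Φ (cfc (g k) X) - Φ (cfc (g k) X) * S
        + S * (t k • Φ (cfc (g k) X)) * S := by
    have := (ht k).ne'
    simp only [sub_mul, mul_sub, one_mul, mul_one, smul_sub, smul_mul_assoc, mul_smul_comm,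
      smul_smul, inv_mul_cancel₀ this, one_smul, inv_mul_cancel_left₀ this]
    abel
  have hsum : ∑ k ∈ Finset.range n,
      (t k)⁻¹ • ((1 - t k • S) * Φ (cfc (g k) X) * (1 - t k • S)) =
      Φ (∑ k ∈ Finset.range n, (t k)⁻¹ • cfc (g k) X) - (2 : ℝ) • S + S * Φ X * S := by
    have e1 : ∑ k ∈ Finset.range n, Φ (cfc (g k) X) = 1 := by rw [← map_sum, h1, hΦ]
    have e2 : ∑ k ∈ Finset.range n, t k • Φ (cfc (g k) X) = Φ X := by
      simp only [← Φ.map_smul_of_tower]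
      rw [← map_sum, h2]
    simp only [hterm, Finset.sum_add_distrib, Finset.sum_sub_distrib, ← Finset.mul_sum,
      ← Finset.sum_mul, e1, e2, map_sum, Φ.map_smul_of_tower, two_smul]
    simp only [mul_one, one_mul]
    abel
  rw [hsum] at hpos
  have h4 := OrderHomClass.mono Φ h3
  rw [map_add, Φ.map_algebraMap hΦ] at h4
  rw [← sub_nonneg]
  refine (add_nonneg hpos (sub_nonneg.2 h4)).trans_eq ?_
  abel

/-- Choi's inequality `Φ(X)⁻¹ ≤ Φ(X⁻¹)` for unital positive maps. -/
theorem PositiveLinearMap.map_rpow_neg_one_le (Φ : 𝒜 →ₚ[ℂ] ℬ) (hΦ : Φ 1 = 1) {X : 𝒜}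
    (hX : IsStrictlyPositive X) (hΦX : IsStrictlyPositive (Φ X)) :
    Φ X ^ (-1 : ℝ) ≤ Φ (X ^ (-1 : ℝ)) := by
  -- The choice `S = Φ(X)⁻¹` collapses the left side to `S`.
  have h := Φ.two_smul_sub_conjugate_le_map_rpow_neg_one hΦ hX
    (IsSelfAdjoint.of_nonneg (CFC.rpow_nonneg (a := Φ X) (y := -1)))
  have e : Φ X ^ (-1 : ℝ) * Φ X = 1 := by
    have := CFC.rpow_neg_mul_rpow (1 : ℝ) hΦX
    rwa [CFC.rpow_one (Φ X) hΦX.nonneg] at this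
  rwa [e, one_mul, two_smul, add_sub_cancel_right] at h

theorem PositiveLinearMap.isStrictlyPositive_map (Φ : 𝒜 →ₚ[ℂ] ℬ) (hΦ : Φ 1 = 1) {X : 𝒜}
    (hX : IsStrictlyPositive X) : IsStrictlyPositive (Φ X) := by
  obtain ⟨a, ha, h⟩ := hX.exists_algebraMap_le
  refine .of_algebraMap_le ha ?_
  rw [← Φ.map_algebraMap hΦ]
  exact OrderHomClass.mono Φ h

theorem add_smul_rpow_neg_one_le {X : 𝒜} {m M : ℝ} (hm : 0 < m)
    (hmX : algebraMap ℝ 𝒜 m ≤ X) (hXM : X ≤ algebraMap ℝ 𝒜 M) :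
    X + (M * m) • X ^ (-1 : ℝ) ≤ algebraMap ℝ 𝒜 (M + m) := by
  have hX : IsStrictlyPositive X := .of_algebraMap_le hm hmX
  have hXsa := hX.isSelfAdjoint
  have hinv : ContinuousOn (fun x : ℝ => x⁻¹) (spectrum ℝ X) :=
    continuousOn_inv₀.mono fun x h => (hX.spectrum_pos h).ne'
  have hinv' : ContinuousOn (fun x : ℝ => (M * m) • x⁻¹) (spectrum ℝ X) := by fun_prop
  have e : X + (M * m) • X ^ (-1 : ℝ) = cfc (fun x : ℝ => x + (M * m) • x⁻¹) X := by
    rw [cfc_add X _ _ (continuousOn_id' _) hinv', cfc_smul _ _ X hinv, cfc_id' ℝ X,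
      CFC.rpow_eq_cfc_real hX.nonneg]
    simp only [Real.rpow_neg_one]
  rw [e]
  refine cfc_le_algebraMap _ _ _ (fun x h => ?_) ((continuousOn_id' _).add hinv')
  have h1 := (algebraMap_le_iff_le_spectrum hXsa).1 hmX x h
  have h2 := (le_algebraMap_iff_spectrum_le hXsa).1 hXM x h
  have hx : 0 < x := hX.spectrum_pos h
  have : (M + m) - (x + M * m * x⁻¹) = (x - m) * (M - x) * x⁻¹ := by field_simp; ring
  have h3 : 0 ≤ (x - m) * (M - x) * x⁻¹ :=
    mul_nonneg (mul_nonneg (by linarith) (by linarith)) (by positivity)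
  rw [smul_eq_mul]
  linarith

end PositiveMaps

/-! ### Norm of a product of positive operators -/

section NormProduct

variable {H : Type*} [NormedAddCommGroup H] [InnerProductSpace ℂ H] [CompleteSpace H]

omit [CompleteSpace H] in
open RCLike in
theorem re_inner_algebraMap_apply_self (r : ℝ) (x : H) :
    re (inner ℂ (algebraMap ℝ (H →L[ℂ] H) r x) x) = r * ‖x‖ ^ 2 := by
  have : algebraMap ℝ (H →L[ℂ] H) r x = (r : ℂ) • x := by
    rw [Algebra.algebraMap_eq_smul_one, Complex.coe_smul]
    rfl
  rw [this, inner_smul_left, Complex.conj_ofReal, re_to_complex, Complex.re_ofReal_mul,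
    ← re_to_complex, inner_self_eq_norm_sq]

-- Let `S = P + W`, `c = Pu + Ww`. Polarization and `S ≥ 0` bound the left side by `⟨Sc, c⟩ ≤
-- N‖c‖²`; positivity of `P` at `Nu - c` and of `W` at `Nw - c` bounds `N‖c‖²` by the right side.
open RCLike in
theorem four_mul_re_inner_add_le {P W : H →L[ℂ] H} (hP : 0 ≤ P) (hW : 0 ≤ W) {N : ℝ}
    (hN : 0 < N) (h : P + W ≤ algebraMap ℝ (H →L[ℂ] H) N) (u w : H) :
    4 * re (inner ℂ ((P + W) (W w)) (P u)) ≤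
      N ^ 2 * (re (inner ℂ (P u) u) + re (inner ℂ (W w) w)) := by
  have hP' := (ContinuousLinearMap.nonneg_iff_isPositive P).1 hP
  have hW' := (ContinuousLinearMap.nonneg_iff_isPositive W).1 hW
  have hS' := (ContinuousLinearMap.nonneg_iff_isPositive _).1 (add_nonneg hP hW)
  have hSN (c : H) : re (inner ℂ (P c) c) + re (inner ℂ (W c) c) ≤ N * ‖c‖ ^ 2 := by
    have := (ContinuousLinearMap.le_def _ _).1 h |>.re_inner_nonneg_left c
    rw [sub_apply, add_apply, inner_sub_left, inner_add_left, map_sub, map_add,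
      re_inner_algebraMap_apply_self] at this
    linarith
  have hT {T : H →L[ℂ] H} (hT : T.IsPositive) (u c : H) :
      2 * N * re (inner ℂ (T u) c) ≤ N ^ 2 * re (inner ℂ (T u) u) + re (inner ℂ (T c) c) := by
    have h1 := hT.re_inner_nonneg_left ((N : ℂ) • u - c)
    have h2 : re (inner ℂ (T c) u) = re (inner ℂ (T u) c) := by
      rw [hT.inner_left_eq_inner_right, inner_re_symm]
    simp only [map_sub, map_smul, inner_sub_left, inner_sub_right, inner_smul_left,
      inner_smul_right, Complex.conj_ofReal, re_to_complex, Complex.re_ofReal_mul, Complex.sub_re] at h1 h2 ⊢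
    rw [h2] at h1
    linarith
  have hc : N * ‖P u + W w‖ ^ 2 ≤ N ^ 2 * (re (inner ℂ (P u) u) + re (inner ℂ (W w) w)) := by
    obtain ⟨c, hc⟩ : ∃ c, c = P u + W w := ⟨_, rfl⟩
    have h1 := hT hP' u c
    have h2 := hT hW' w c
    have h3 : re (inner ℂ (P u) c) + re (inner ℂ (W w) c) = ‖c‖ ^ 2 := by
      rw [← map_add, ← inner_add_left, ← hc, inner_self_eq_norm_sq]
    have h4 := hSN c
    rw [← hc]
    nlinarith
  have h1 := hSN (P u + W w)
  have h2 := hS'.re_inner_nonneg_left (P u - W w)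
  have h3 : re (inner ℂ ((P + W) (P u)) (W w)) = re (inner ℂ ((P + W) (W w)) (P u)) := by
    rw [hS'.inner_left_eq_inner_right, inner_re_symm]
  have h4 : re (inner ℂ ((P + W) (P u + W w)) (P u + W w)) ≤ N * ‖P u + W w‖ ^ 2 := by
    rw [add_apply, inner_add_left, map_add]
    exact h1
  rw [map_add] at h4
  rw [map_sub] at h2
  simp only [inner_add_left, inner_add_right, inner_sub_left, inner_sub_right, map_add,
    map_sub] at h2 h4
  linarith

open RCLike in
/-- The Bhatia–Kittaneh inequality `‖P W‖ ≤ ‖P + W‖² / 4`, for invertible `W`. -/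
theorem norm_mul_le_sq_div_four {P W : H →L[ℂ] H} (hP : 0 ≤ P) (hW : IsStrictlyPositive W) {N : ℝ}
    (hN : 0 < N) (h : P + W ≤ algebraMap ℝ (H →L[ℂ] H) N) : ‖P * W‖ ≤ N ^ 2 / 4 := by
  by_contra! hlt
  obtain ⟨k, hk⟩ : ∃ k, k = ‖P * W‖ := ⟨_, rfl⟩
  rw [← hk] at hlt
  have hk0 : 0 < k := lt_trans (by positivity) hlt
  have hP' := (ContinuousLinearMap.nonneg_iff_isPositive P).1 hP
  have hW' := (ContinuousLinearMap.nonneg_iff_isPositive W).1 hW.nonneg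
  obtain ⟨δ, hδ, hδW⟩ := hW.exists_algebraMap_le
  have hδ' (w : H) : δ * ‖w‖ ^ 2 ≤ re (inner ℂ (W w) w) := by
    have := (ContinuousLinearMap.le_def _ _).1 hδW |>.re_inner_nonneg_left w
    rw [sub_apply, inner_sub_left, map_sub, re_inner_algebraMap_apply_self] at this
    linarith
  have hWP (w : H) : ‖W (P w)‖ ≤ k * ‖w‖ := by
    have e : star (P * W) = W * P := by
      rw [star_mul, hP'.isSelfAdjoint.star_eq, hW'.isSelfAdjoint.star_eq]
    have := (W * P).le_opNorm w
    rwa [← e, norm_star, ← hk, e] at this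
  -- For an exact singular pair `PWw = ku`, `WPu = kw`, the previous inequality would force `4k ≤
  -- N²`. Norms need not be attained, so the defect `d = WPPWw - k²w` is carried along and `4k > N²`
  -- bounds it below.
  have hd (w : H) : (4 * k - N ^ 2) * δ * ‖w‖ ^ 2 ≤
      4 * k⁻¹ * (‖W‖ * ‖w‖ * ‖W (P (P (W w))) - ((k ^ 2 : ℝ) : ℂ) • w‖) := by
    obtain ⟨d, hd⟩ : ∃ d, d = W (P (P (W w))) - ((k ^ 2 : ℝ) : ℂ) • w := ⟨_, rfl⟩
    obtain ⟨u, hu⟩ : ∃ u, u = ((k⁻¹ : ℝ) : ℂ) • P (W w) := ⟨_, rfl⟩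
    have h1 := four_mul_re_inner_add_le hP hW.nonneg hN h u w
    have hku : P (W w) = (k : ℂ) • u := by
      rw [hu, smul_smul, ← Complex.ofReal_mul, mul_inv_cancel₀ hk0.ne', Complex.ofReal_one,
        one_smul]
    have hWPu : W (P u) = (k : ℂ) • w + ((k⁻¹ : ℝ) : ℂ) • d := by
      rw [hd, hu, map_smul, map_smul, smul_sub, smul_smul, ← Complex.ofReal_mul,
        show k⁻¹ * k ^ 2 = k by field_simp]
      abel
    have h2 : re (inner ℂ ((P + W) (W w)) (P u)) =
        k * re (inner ℂ (P u) u) + k * re (inner ℂ (W w) w) + k⁻¹ * re (inner ℂ (W w) d) := by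
      rw [add_apply, inner_add_left, hW'.inner_left_eq_inner_right (W w),
        hWPu, hku, inner_add_right, map_add, map_add, inner_re_symm, ← add_assoc]
      simp only [inner_smul_right, re_to_complex, Complex.re_ofReal_mul]
    have h3 : -(‖W‖ * ‖w‖ * ‖d‖) ≤ re (inner ℂ (W w) d) := by
      have h4 : |re (inner ℂ (W w) d)| ≤ ‖W w‖ * ‖d‖ :=
        (abs_re_le_norm _).trans (norm_inner_le_norm _ _)
      have h5 : ‖W w‖ * ‖d‖ ≤ ‖W‖ * ‖w‖ * ‖d‖ := by gcongr; exact W.le_opNorm w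
      linarith [(abs_le.1 h4).1]
    have h4 := hP'.re_inner_nonneg_left u
    have h5 : k⁻¹ * -(‖W‖ * ‖w‖ * ‖d‖) ≤ k⁻¹ * re (inner ℂ (W w) d) := by gcongr
    have h6 : 0 < 4 * k - N ^ 2 := by linarith
    have h7 := mul_le_mul_of_nonneg_left (hδ' w) h6.le
    have h8 := mul_nonneg h6.le h4
    rw [← hd]
    rw [h2] at h1
    linarith
  -- Conversely the defect is small wherever `‖PWw‖` is close to `k‖w‖`; a uniform lower bound on it
  -- thus makes `‖PW‖ < k`.
  have hd2 (w : H) : ‖W (P (P (W w))) - ((k ^ 2 : ℝ) : ℂ) • w‖ ^ 2 ≤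
      k ^ 2 * (k ^ 2 * ‖w‖ ^ 2 - ‖P (W w)‖ ^ 2) := by
    have h1 : re (inner ℂ (W (P (P (W w)))) w) = ‖P (W w)‖ ^ 2 := by
      rw [hW'.inner_left_eq_inner_right, hP'.inner_left_eq_inner_right, inner_self_eq_norm_sq]
    have h2 : ‖W (P (P (W w)))‖ ^ 2 ≤ (k * ‖P (W w)‖) ^ 2 :=
      pow_le_pow_left₀ (norm_nonneg _) (hWP _) 2
    rw [@norm_sub_sq ℂ, inner_smul_right, re_to_complex, Complex.re_ofReal_mul,
      ← re_to_complex, h1, norm_smul, Complex.norm_real, Real.norm_of_nonneg (by positivity)]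
    linarith
  obtain ⟨η, hη⟩ : ∃ η, η = (4 * k - N ^ 2) * δ * k / (4 * (‖W‖ + 1)) := ⟨_, rfl⟩
  have hη0 : 0 < η := by
    rw [hη]
    have : 0 < 4 * k - N ^ 2 := by linarith
    positivity
  have hη1 (w : H) : η * ‖w‖ ≤ ‖W (P (P (W w))) - ((k ^ 2 : ℝ) : ℂ) • w‖ := by
    rcases eq_or_ne w 0 with rfl | hw
    · simp
    have hw0 : 0 < ‖w‖ := norm_pos_iff.2 hw
    have h1 := hd w
    obtain ⟨e, he⟩ : ∃ e, e = ‖W (P (P (W w))) - ((k ^ 2 : ℝ) : ℂ) • w‖ := ⟨_, rfl⟩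
    have he0 : 0 ≤ e := he ▸ norm_nonneg _
    rw [← he] at h1 ⊢
    have h2 : (4 * k - N ^ 2) * δ * k * ‖w‖ ≤ 4 * (‖W‖ * e) := by
      refine le_of_mul_le_mul_right ?_ (mul_pos (inv_pos.2 hk0) hw0)
      calc _ = (4 * k - N ^ 2) * δ * ‖w‖ ^ 2 := by field_simp
        _ ≤ _ := h1
        _ = _ := by ring
    rw [hη, div_mul_eq_mul_div, div_le_iff₀ (by positivity)]
    linarith
  have hfin : k ≤ Real.sqrt (k ^ 2 - η ^ 2 / k ^ 2) := by
    conv_lhs => rw [hk]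
    refine ContinuousLinearMap.opNorm_le_bound _ (Real.sqrt_nonneg _) fun w => ?_
    rw [mul_apply_eq_comp]
    have h1 : (η * ‖w‖) ^ 2 ≤ k ^ 2 * (k ^ 2 * ‖w‖ ^ 2 - ‖P (W w)‖ ^ 2) :=
      (pow_le_pow_left₀ (by positivity) (hη1 w) 2).trans (hd2 w)
    rw [← Real.sqrt_sq (norm_nonneg w), ← Real.sqrt_mul' _ (sq_nonneg _)]
    refine Real.le_sqrt_of_sq_le ?_
    refine le_of_mul_le_mul_left ?_ (pow_pos hk0 2)
    have : k ^ 2 * ((k ^ 2 - η ^ 2 / k ^ 2) * ‖w‖ ^ 2) = k ^ 4 * ‖w‖ ^ 2 - η ^ 2 * ‖w‖ ^ 2 := by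
      field_simp
    rw [this]
    linarith
  rw [Real.le_sqrt' hk0] at hfin
  have : 0 < η ^ 2 / k ^ 2 := by positivity
  linarith

/-- If `P + c Q⁻¹ ≤ N` then `P² ≤ (N² / 4c)² Q²`. -/
theorem sq_le_smul_sq_of_add_smul_le {P Q R : H →L[ℂ] H} (hP : 0 ≤ P) (hR : IsStrictlyPositive R)
    (hQ : IsSelfAdjoint Q) (hRQ : R * Q = 1) {c N : ℝ} (hc : 0 < c) (hN : 0 < N)
    (h : P + c • R ≤ algebraMap ℝ (H →L[ℂ] H) N) :
    P ^ 2 ≤ (N ^ 2 / (4 * c)) ^ 2 • Q ^ 2 := by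
  have h1 := norm_mul_le_sq_div_four hP (hR.smul hc) hN h
  have hPsa := IsSelfAdjoint.of_nonneg hP
  have hRsa := hR.isSelfAdjoint
  have hQR : Q * R = 1 := by
    have := congr_arg star hRQ
    rwa [star_mul, hRsa.star_eq, hQ.star_eq, star_one] at this
  have h2 : ‖P * R‖ ≤ N ^ 2 / (4 * c) := by
    rw [mul_smul_comm, norm_smul, Real.norm_of_nonneg hc.le] at h1
    rw [le_div_iff₀ (by positivity)]
    linarith
  -- This reads `R P² R ≤ (N²/4c)²`; conjugating by `Q = R⁻¹` removes both `R`.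
  have h3 : star (P * R) * (P * R) ≤ algebraMap ℝ (H →L[ℂ] H) ((N ^ 2 / (4 * c)) ^ 2) :=
    CStarAlgebra.star_mul_le_algebraMap_norm_sq.trans
      (algebraMap_mono _ (pow_le_pow_left₀ (norm_nonneg _) h2 2))
  have h4 := hQ.conjugate_le_conjugate h3
  have e : Q * (star (P * R) * (P * R)) * Q = P ^ 2 := by
    rw [star_mul, hPsa.star_eq, hRsa.star_eq]
    calc _ = (Q * R) * P * P * (R * Q) := by simp only [mul_assoc]
      _ = _ := by rw [hQR, hRQ, one_mul, mul_one, sq]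
  rwa [e, Algebra.algebraMap_eq_smul_one, mul_smul_comm, smul_mul_assoc, mul_one, ← sq] at h4

end NormProduct

/-! ### Operator powers and the functional calculus form of Young's inequality -/

section Means

variable {𝒜 : Type*} [CStarAlgebra 𝒜] [PartialOrder 𝒜] [StarOrderedRing 𝒜]

theorem CFC.rpow_neg_one_mul_self {A : 𝒜} (hA : IsStrictlyPositive A) : A ^ (-1 : ℝ) * A = 1 := by
  have := CFC.rpow_neg_mul_rpow (1 : ℝ) hA
  rwa [CFC.rpow_one A hA.nonneg] at this

theorem CFC.rpow_neg_one_eq_of_mul_eq_one {A X : 𝒜} (hA : IsStrictlyPositive A) (h : A * X = 1) :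
    A ^ (-1 : ℝ) = X := by
  rw [← mul_one (A ^ (-1 : ℝ)), ← h, ← mul_assoc, CFC.rpow_neg_one_mul_self hA, one_mul]

theorem CFC.rpow_neg_half_mul_rpow_half {A : 𝒜} (hA : IsStrictlyPositive A) :
    A ^ (-(1 / 2) : ℝ) * A ^ (1 / 2 : ℝ) = 1 :=
  CFC.rpow_neg_mul_rpow _ hA

theorem CFC.rpow_half_mul_rpow_neg_half {A : 𝒜} (hA : IsStrictlyPositive A) :
    A ^ (1 / 2 : ℝ) * A ^ (-(1 / 2) : ℝ) = 1 :=
  CFC.rpow_mul_rpow_neg _ hA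

theorem IsStrictlyPositive.rpow_conjugate {A B : 𝒜} (hA : IsStrictlyPositive A)
    (hB : IsStrictlyPositive B) (s : ℝ) : IsStrictlyPositive (A ^ s * B * A ^ s) :=
  .conjugate_of_isUnit_of_isSelfAdjoint _ _ (IsStrictlyPositive.rpow A s hA).isUnit (IsStrictlyPositive.rpow A s hA).isSelfAdjoint hB

theorem rpow_neg_one_eq_conjugate {A B : 𝒜} (hA : IsStrictlyPositive A)
    (hB : IsStrictlyPositive B) :
    B ^ (-1 : ℝ) = A ^ (-(1 / 2) : ℝ) * (A ^ (-(1 / 2) : ℝ) * B * A ^ (-(1 / 2) : ℝ)) ^ (-1 : ℝ) *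
      A ^ (-(1 / 2) : ℝ) := by
  have h1 := CFC.rpow_neg_one_mul_self (hA.rpow_conjugate hB (-(1 / 2)))
  obtain ⟨D, hD⟩ : ∃ D, D = (A ^ (-(1 / 2) : ℝ) * B * A ^ (-(1 / 2) : ℝ)) ^ (-1 : ℝ) := ⟨_, rfl⟩
  obtain ⟨S, hS⟩ : ∃ S, S = A ^ (-(1 / 2) : ℝ) := ⟨_, rfl⟩
  obtain ⟨R, hR⟩ : ∃ R, R = A ^ (1 / 2 : ℝ) := ⟨_, rfl⟩
  have hSR : S * R = 1 := by rw [hS, hR, CFC.rpow_neg_half_mul_rpow_half hA]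
  have hRS : R * S = 1 := by rw [hS, hR, CFC.rpow_half_mul_rpow_neg_half hA]
  rw [← hD, ← hS] at h1
  rw [← hD, ← hS]
  have h2 : S * D * S * B = 1 := by
    calc S * D * S * B = S * (D * (S * B * S)) * R := by
          simp only [mul_assoc, hSR, mul_one]
      _ = 1 := by rw [h1, mul_one, hSR]
  refine (left_inv_eq_right_inv h2 ?_).symm
  have := CFC.rpow_mul_rpow_neg (1 : ℝ) hB
  rwa [CFC.rpow_one B hB.nonneg] at this

theorem kantorovich_rpow_smul_rpow_neg_le {C : 𝒜} (hC : IsStrictlyPositive C) {h ν : ℝ}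
    (hh : 1 ≤ h) (hhC : algebraMap ℝ 𝒜 h ≤ C ∨ C ≤ algebraMap ℝ 𝒜 h⁻¹)
    (hν : ν ∈ Set.Icc (0 : ℝ) 1) :
    kantorovich h ^ min ν (1 - ν) • C ^ (-ν) ≤ (1 - ν) • (1 : 𝒜) + ν • C ^ (-1 : ℝ) := by
  have hsa := hC.isSelfAdjoint
  have hpow (s : ℝ) : ContinuousOn (fun x : ℝ => x ^ s) (spectrum ℝ C) :=
    continuousOn_id.rpow_const fun x h => Or.inl (hC.spectrum_pos h).ne'
  have hν' := hpow (-ν)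
  have h1' := hpow (-1)
  have hx' : ∀ x ∈ spectrum ℝ C, h ≤ x ∨ x ≤ h⁻¹ := fun x hx => hhC.imp
    (fun H => (algebraMap_le_iff_le_spectrum hsa).1 H x hx)
    (fun H => (le_algebraMap_iff_spectrum_le hsa).1 H x hx)
  rw [CFC.rpow_eq_cfc_real hC.nonneg, CFC.rpow_eq_cfc_real hC.nonneg,
    ← Algebra.algebraMap_eq_smul_one, ← cfc_const (1 - ν) C, ← cfc_smul _ _ C hν',
    ← cfc_smul _ _ C h1', ← cfc_add C _ _ continuousOn_const (by fun_prop)]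
  refine cfc_mono (fun x hx => ?_) (by fun_prop) (by fun_prop)
  rw [Real.rpow_neg_one]
  exact kantorovich_rpow_mul_rpow_neg_le hh (hC.spectrum_pos hx) (hx' x hx) hν

end Means

/-! ### Operator means and the main estimate -/

section GeometricMean

variable {H : Type*} [NormedAddCommGroup H] [InnerProductSpace ℂ H] [CompleteSpace H]
variable {L : Type*} [NormedAddCommGroup L] [InnerProductSpace ℂ L] [CompleteSpace L]

theorem isStrictlyPositive_geomMean {A B : H →L[ℂ] H} (hA : IsStrictlyPositive A)
    (hB : IsStrictlyPositive B) (ν : ℝ) : IsStrictlyPositive (geomMean ν A B) :=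
  hA.rpow_conjugate (IsStrictlyPositive.rpow _ ν (hA.rpow_conjugate hB _)) _

theorem geomMean_rpow_neg_one {A B : H →L[ℂ] H} (hA : IsStrictlyPositive A)
    (hB : IsStrictlyPositive B) (ν : ℝ) :
    geomMean ν A B ^ (-1 : ℝ) = A ^ (-(1 / 2) : ℝ) *
      (A ^ (-(1 / 2) : ℝ) * B * A ^ (-(1 / 2) : ℝ)) ^ (-ν) * A ^ (-(1 / 2) : ℝ) := by
  refine CFC.rpow_neg_one_eq_of_mul_eq_one (isStrictlyPositive_geomMean hA hB ν) ?_
  have hC := hA.rpow_conjugate hB (-(1 / 2))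
  rw [geomMean]
  simp only [mul_assoc]
  rw [← mul_assoc (A ^ (1 / 2 : ℝ)) (A ^ (-(1 / 2) : ℝ)), CFC.rpow_half_mul_rpow_neg_half hA,
    one_mul, ← mul_assoc (_ ^ ν) (_ ^ (-ν))]
  simp only [← mul_assoc]
  rw [mul_assoc (A ^ (1 / 2 : ℝ)), CFC.rpow_mul_rpow_neg ν hC, mul_one,
    CFC.rpow_half_mul_rpow_neg_half hA]

/-- The refined Young inequality `K(h)^r (A #_ν B)⁻¹ ≤ A⁻¹ ∇_ν B⁻¹`. -/
theorem kantorovich_rpow_smul_geomMean_inv_le {A B : H →L[ℂ] H} (hA : IsStrictlyPositive A)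
    (hB : IsStrictlyPositive B) {h ν : ℝ} (hh : 1 ≤ h) (hhAB : h • A ≤ B ∨ B ≤ h⁻¹ • A)
    (hν : ν ∈ Set.Icc (0 : ℝ) 1) :
    kantorovich h ^ min ν (1 - ν) • geomMean ν A B ^ (-1 : ℝ) ≤
      arithMean ν (A ^ (-1 : ℝ)) (B ^ (-1 : ℝ)) := by
  have hS : IsSelfAdjoint (A ^ (-(1 / 2) : ℝ)) := (IsStrictlyPositive.rpow A _ hA).isSelfAdjoint
  have hconj (r : ℝ) : A ^ (-(1 / 2) : ℝ) * (r • A) * A ^ (-(1 / 2) : ℝ) =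
      algebraMap ℝ (H →L[ℂ] H) r := by
    rw [mul_smul_comm, smul_mul_assoc, CFC.conjugate_rpow_neg_one_half A hA,
      Algebra.algebraMap_eq_smul_one]
  -- The one-variable inequality at `C = A^(-1/2) B A^(-1/2)`; a second conjugation by `A^(-1/2)`
  -- gives back the means.
  have key := kantorovich_rpow_smul_rpow_neg_le (hA.rpow_conjugate hB (-(1 / 2))) hh
    (hhAB.imp (fun H => by rw [← hconj]; exact hS.conjugate_le_conjugate H)
      (fun H => by rw [← hconj]; exact hS.conjugate_le_conjugate H)) hν
  have key' := hS.conjugate_le_conjugate key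
  have hA1 : A ^ (-(1 / 2) : ℝ) * A ^ (-(1 / 2) : ℝ) = A ^ (-1 : ℝ) := by
    rw [← CFC.rpow_add hA.isUnit]; norm_num
  rw [geomMean_rpow_neg_one hA hB, arithMean, rpow_neg_one_eq_conjugate hA hB]
  simpa only [mul_add, add_mul, mul_smul_comm, smul_mul_assoc, mul_one, hA1] using key'

/-- The separation of `A` and `B` enters only through `h • A ≤ B` or `B ≤ h⁻¹ • A`, a form that
positive linear maps preserve, so the lemma also applies to `Φ A`, `Φ B`. -/
theorem PositiveLinearMap.map_arithMean_sq_le (Φ : (H →L[ℂ] H) →ₚ[ℂ] (L →L[ℂ] L))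
    (hΦ : Φ 1 = 1) {A B : H →L[ℂ] H} {m M h ν : ℝ} (hm : 0 < m) (hM : 0 < M)
    (hmA : algebraMap ℝ (H →L[ℂ] H) m ≤ A) (hAM : A ≤ algebraMap ℝ (H →L[ℂ] H) M)
    (hmB : algebraMap ℝ (H →L[ℂ] H) m ≤ B) (hBM : B ≤ algebraMap ℝ (H →L[ℂ] H) M)
    (hh : 1 ≤ h) (hhAB : h • A ≤ B ∨ B ≤ h⁻¹ • A) (hν : ν ∈ Set.Icc (0 : ℝ) 1) :
    Φ (arithMean ν A B) ^ 2 ≤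
      (kantorovich (M / m) / kantorovich h ^ min ν (1 - ν)) ^ 2 • Φ (geomMean ν A B) ^ 2 := by
  have hA : IsStrictlyPositive A := .of_algebraMap_le hm hmA
  have hB : IsStrictlyPositive B := .of_algebraMap_le hm hmB
  have hG := isStrictlyPositive_geomMean hA hB ν
  have hΦG := Φ.isStrictlyPositive_map hΦ hG
  obtain ⟨hν0, hν1⟩ := hν
  have hν1' : 0 ≤ 1 - ν := sub_nonneg.2 hν1
  have hK : 0 < kantorovich h := zero_lt_one.trans_le (one_le_kantorovich (by linarith))
  have hKr : 0 < kantorovich h ^ min ν (1 - ν) := Real.rpow_pos_of_pos hK _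
  have hP : 0 ≤ arithMean ν A B :=
    add_nonneg (smul_nonneg hν1' hA.nonneg) (smul_nonneg hν0 hB.nonneg)
  have hsum : arithMean ν A B + (M * m) • arithMean ν (A ^ (-1 : ℝ)) (B ^ (-1 : ℝ)) ≤
      algebraMap ℝ (H →L[ℂ] H) (M + m) := by
    have h1 := add_le_add
      (smul_le_smul_of_nonneg_left (add_smul_rpow_neg_one_le hm hmA hAM) hν1')
      (smul_le_smul_of_nonneg_left (add_smul_rpow_neg_one_le hm hmB hBM) hν0)
    rw [← add_smul, sub_add_cancel, one_smul] at h1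
    refine le_of_eq_of_le ?_ h1
    rw [arithMean, arithMean]
    module
  have hG1 : arithMean ν A B +
      (M * m * kantorovich h ^ min ν (1 - ν)) • geomMean ν A B ^ (-1 : ℝ) ≤
      algebraMap ℝ (H →L[ℂ] H) (M + m) := by
    refine le_trans (add_le_add_right ?_ _) hsum
    rw [mul_smul]
    exact smul_le_smul_of_nonneg_left
      (kantorovich_rpow_smul_geomMean_inv_le hA hB hh hhAB ⟨hν0, hν1⟩) (by positivity)
  have hΦ1 := OrderHomClass.mono Φ hG1
  rw [map_add, Φ.map_smul_of_tower, Φ.map_algebraMap hΦ] at hΦ1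
  have hc : 0 < M * m * kantorovich h ^ min ν (1 - ν) := by positivity
  have hfin : Φ (arithMean ν A B) +
      (M * m * kantorovich h ^ min ν (1 - ν)) • Φ (geomMean ν A B) ^ (-1 : ℝ) ≤
      algebraMap ℝ (L →L[ℂ] L) (M + m) :=
    le_trans (add_le_add_right
      (smul_le_smul_of_nonneg_left (Φ.map_rpow_neg_one_le hΦ hG hΦG) hc.le) _) hΦ1
  have h2 := sq_le_smul_sq_of_add_smul_le (Φ.map_nonneg hP) (IsStrictlyPositive.rpow _ (-1) hΦG)
    hΦG.isSelfAdjoint (CFC.rpow_neg_one_mul_self hΦG) hc (by linarith) hfin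
  have e : (M + m) ^ 2 / (4 * (M * m * kantorovich h ^ min ν (1 - ν))) =
      kantorovich (M / m) / kantorovich h ^ min ν (1 - ν) := by
    rw [show kantorovich (M / m) = (M + m) ^ 2 / (4 * (M * m)) by
      unfold kantorovich; field_simp]
    field_simp
  rwa [e] at h2

theorem smul_le_of_le_algebraMap {A B : H →L[ℂ] H} {m' M' : ℝ} (hm' : 0 < m') (hM' : 0 < M')
    (hA : A ≤ algebraMap ℝ (H →L[ℂ] H) m') (hB : algebraMap ℝ (H →L[ℂ] H) M' ≤ B) :
    (M' / m') • A ≤ B := by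
  refine (smul_le_smul_of_nonneg_left hA (by positivity)).trans (le_of_eq_of_le ?_ hB)
  rw [Algebra.algebraMap_eq_smul_one, Algebra.algebraMap_eq_smul_one, smul_smul,
    div_mul_cancel₀ _ hm'.ne']

end GeometricMean

/-! ### The theorem -/

theorem mainTheorem1
    {H : Type*} [NormedAddCommGroup H] [InnerProductSpace ℂ H] [CompleteSpace H]
    {L : Type*} [NormedAddCommGroup L] [InnerProductSpace ℂ L] [CompleteSpace L]
    (Φ : (H →L[ℂ] H) →ₚ[ℂ] (L →L[ℂ] L)) (hΦ : Φ 1 = 1)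
    (A B : H →L[ℂ] H) (m m' M' M ν : ℝ)
    (hm : 0 < m) (hmM' : m' < M')
    (hAB :
      (algebraMap ℝ (H →L[ℂ] H) m ≤ B ∧ B ≤ algebraMap ℝ (H →L[ℂ] H) m' ∧
        algebraMap ℝ (H →L[ℂ] H) M' ≤ A ∧ A ≤ algebraMap ℝ (H →L[ℂ] H) M) ∨
      (algebraMap ℝ (H →L[ℂ] H) m ≤ A ∧ A ≤ algebraMap ℝ (H →L[ℂ] H) m' ∧
        algebraMap ℝ (H →L[ℂ] H) M' ≤ B ∧ B ≤ algebraMap ℝ (H →L[ℂ] H) M))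
    (hν : ν ∈ Set.Icc (0 : ℝ) 1) :
    Φ (arithMean ν A B) ^ 2 ≤
        (kantorovich (M / m) / kantorovich (M' / m') ^ min ν (1 - ν)) ^ 2 •
          Φ (geomMean ν A B) ^ 2 ∧
    Φ (arithMean ν A B) ^ 2 ≤
        (kantorovich (M / m) / kantorovich (M' / m') ^ min ν (1 - ν)) ^ 2 •
          geomMean ν (Φ A) (Φ B) ^ 2 := by
  
  -- On the zero space the operator bounds say nothing about the scalars; otherwise a spectral point
  -- yields `m ≤ m'` and `M' ≤ M`.
  rcases subsingleton_or_nontrivial (H →L[ℂ] H) with hs | hs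
  · have h01 : (0 : L →L[ℂ] L) = 1 := by rw [← hΦ, Subsingleton.elim (1 : H →L[ℂ] H) 0, map_zero]
    have := subsingleton_of_zero_eq_one h01
    exact ⟨(Subsingleton.elim _ _).le, (Subsingleton.elim _ _).le⟩
  have hle {X : H →L[ℂ] H} {a b : ℝ} (ha : algebraMap ℝ (H →L[ℂ] H) a ≤ X)
      (hb : X ≤ algebraMap ℝ (H →L[ℂ] H) b) : a ≤ b := by
    have hX : IsSelfAdjoint X := by
      simpa using (IsSelfAdjoint.of_nonneg (sub_nonneg.2 ha)).add
        ((IsSelfAdjoint.all a).algebraMap (H →L[ℂ] H))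
    rcases CStarAlgebra.norm_or_neg_norm_mem_spectrum hX with hx | hx <;>
    exact ((algebraMap_le_iff_le_spectrum hX).1 ha _ hx).trans
      ((le_algebraMap_iff_spectrum_le hX).1 hb _ hx)
  have hmon {a b : ℝ} (h : a ≤ b) : algebraMap ℝ (H →L[ℂ] H) a ≤ algebraMap ℝ (H →L[ℂ] H) b :=
    algebraMap_mono _ h
  obtain ⟨hm', hM⟩ : m ≤ m' ∧ M' ≤ M := by
    rcases hAB with ⟨h1, h2, h3, h4⟩ | ⟨h1, h2, h3, h4⟩ <;> exact ⟨hle h1 h2, hle h3 h4⟩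
  have hm'0 : 0 < m' := by linarith
  have hM'0 : 0 < M' := by linarith
  have hh : 1 ≤ M' / m' := by rw [one_le_div hm'0]; exact hmM'.le
  obtain ⟨hmA, hAM, hmB, hBM, hAB'⟩ :
      algebraMap ℝ (H →L[ℂ] H) m ≤ A ∧ A ≤ algebraMap ℝ (H →L[ℂ] H) M ∧
      algebraMap ℝ (H →L[ℂ] H) m ≤ B ∧ B ≤ algebraMap ℝ (H →L[ℂ] H) M ∧
      ((M' / m') • A ≤ B ∨ B ≤ (M' / m')⁻¹ • A) := by
    rcases hAB with ⟨h1, h2, h3, h4⟩ | ⟨h1, h2, h3, h4⟩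
    · refine ⟨(hmon (by linarith)).trans h3, h4, h1, h2.trans (hmon (by linarith)), Or.inr ?_⟩
      have h5 := smul_le_smul_of_nonneg_left (smul_le_of_le_algebraMap hm'0 hM'0 h2 h3)
        (show 0 ≤ (M' / m')⁻¹ by positivity)
      rwa [inv_smul_smul₀ (by positivity)] at h5
    · exact ⟨h1, h2.trans (hmon (by linarith)), (hmon (by linarith)).trans h3, h4,
        Or.inl (smul_le_of_le_algebraMap hm'0 hM'0 h2 h3)⟩
  have hM0 : 0 < M := by linarith
  refine ⟨Φ.map_arithMean_sq_le hΦ hm hM0 hmA hAM hmB hBM hh hAB' hν, ?_⟩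
  have hΦle {X Y : H →L[ℂ] H} (h : X ≤ Y) : Φ X ≤ Φ Y := OrderHomClass.mono Φ h
  have hmean : Φ (arithMean ν A B) = arithMean ν (Φ A) (Φ B) := by
    rw [arithMean, arithMean, map_add, Φ.map_smul_of_tower, Φ.map_smul_of_tower]
  rw [hmean]
  refine (PositiveLinearMap.id ℂ (L →L[ℂ] L)).map_arithMean_sq_le rfl hm hM0 ?_ ?_ ?_ ?_ hh ?_ hν
  · exact Φ.map_algebraMap hΦ m ▸ hΦle hmA
  · exact Φ.map_algebraMap hΦ M ▸ hΦle hAM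
  · exact Φ.map_algebraMap hΦ m ▸ hΦle hmB
  · exact Φ.map_algebraMap hΦ M ▸ hΦle hBM
  · rw [← Φ.map_smul_of_tower, ← Φ.map_smul_of_tower]
    exact hAB'.imp hΦle hΦle
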